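/- All spaces are Hausdorff. Let $L=2^{\omega_1}_{\mathrm{lex}}$ be the set of all functions $\omega_1\to\{0,1\}$, ordered lexicographically and given the order topology, and let $K=2^{\omega}\times L$, where $2^\omega=\{0,1\}^{\omega}$ has the product topology. Call points $a,b$ of a compact space $X$ pin equivalent if there are a compact space $Y$, a continuous surjection $f\colon Y\to X$ and a homeomorphism $g\colon Y\to Y$ with $g(f^{-1}\{a\})=f^{-1}\{b\}$; call $X$ pin homogeneous if every two points of $X$ are pin equivalent. The $\pi$-character of a point $a\in X$ is the least cardinality of a family of nonempty open subsets of $X$ such that every neighborhood of $a$ contains a member of the family. For directed sets $P,Q$, write $P\le_T Q$ if there is a map $f\colon Q\to P$ such that for every $p_0\in P$ there is $q_0\in Q$ with $f(q)\ge p_0$ for all $q\ge q_0$; $P$ and $Q$ are Tukey equivalent if $P\le_T Q\le_T P$. The point $a$ has Tukey type $P$ if its neighborhood filter, ordered by $\supseteq$, is Tukey equivalent to $P$. **Theorem.** The space $K=2^\omega\times 2^{\omega_1}_{\mathrm{lex}}$ is compact (Hausdorff) and pin homogeneous. Every point of $K$ has $\pi$-character $\omega$ or $\omega_1$, and both values are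 attained. Every point of $K$ has Tukey type $\omega\times\omega_1$ (with the coordinatewise order). -/

import Mathlib

open scoped Ordinal Cardinal Topology

universe u v

/-- `2^α_lex` for an ordinal `α`: all functions from (the ordinals below) `α` to `2 = {0, 1}`, here
`Bool` with `false < true`, ordered lexicographically. -/
def LexPower (α : Ordinal.{0}) : Type := Lex (α.ToType → Bool)

/-- The lexicographic order: `f < g` iff `f i < g i` at the least `i` where `f` and `g` differ. -/
noncomputable instance (α : Ordinal.{0}) : LinearOrder (LexPower α) :=
  inferInstanceAs (LinearOrder (Lex (α.ToType → Bool)))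

/-- The topology of `2^α_lex` is the order topology. -/
noncomputable instance (α : Ordinal.{0}) : TopologicalSpace (LexPower α) := Preorder.topology (LexPower α)

instance (α : Ordinal.{0}) : OrderTopology (LexPower α) := ⟨rfl⟩

/-- `K = 2^ω × 2^{ω₁}_lex`, the product of the Cantor space `2^ω` (product topology) and
`2^{ω₁}_lex` (order topology), with the product topology. -/
abbrev CantorLexProduct : Type := (ℕ → Bool) × LexPower ω₁

/-- Pin equivalence of two subsets `A`, `B` of a compact Hausdorff space `X`: there are a compact
Hausdorff space `Y`, a continuous surjection `f : Y → X` and a homeomorphism `g : Y → Y` such that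
`g (f⁻¹ A) = f⁻¹ B`. -/
def PinEquivSets {X : Type u} [TopologicalSpace X] (A B : Set X) : Prop :=
  ∃ (Y : Type u) (_ : TopologicalSpace Y) (_ : CompactSpace Y) (_ : T2Space Y)
    (f : Y → X) (g : Y ≃ₜ Y),
    Continuous f ∧ Function.Surjective f ∧ g '' (f ⁻¹' A) = f ⁻¹' B

/-- Pin equivalence of points. -/
def PinEquiv {X : Type u} [TopologicalSpace X] (a b : X) : Prop :=
  PinEquivSets ({a} : Set X) {b}

/-- A compact Hausdorff space is pin homogeneous if all pairs of points are pin equivalent. -/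
def PinHomogeneous (X : Type u) [TopologicalSpace X] : Prop :=
  ∀ a b : X, PinEquiv a b

/-- A family `F` of nonempty open sets is a local `π`-base at `a` if every neighborhood of `a`
contains an element of `F`. -/
def IsLocalPiBase {X : Type u} [TopologicalSpace X] (a : X) (F : Set (Set X)) : Prop :=
  (∀ U ∈ F, IsOpen U ∧ U.Nonempty) ∧ ∀ N ∈ 𝓝 a, ∃ U ∈ F, U ⊆ N

/-- The `π`-character of a point `a`: the least cardinality of a local `π`-base at `a`. (There is
always one, namely the family of all nonempty open sets.) -/
noncomputable def piCharacter {X : Type u} [TopologicalSpace X] (a : X) : Cardinal.{u} :=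
  sInf {κ | ∃ F : Set (Set X), IsLocalPiBase a F ∧ Cardinal.mk F = κ}

/-- `P ≤_T Q`: there is a convergent map `f : Q → P`, that is, for every `p₀` there is `q₀` such
that `f q ≥ p₀` for all `q ≥ q₀`. -/
def TukeyLE (P : Type u) (Q : Type v) [Preorder P] [Preorder Q] : Prop :=
  ∃ f : Q → P, ∀ p₀ : P, ∃ q₀ : Q, ∀ q, q₀ ≤ q → p₀ ≤ f q

/-- Tukey equivalence. -/
def TukeyEquiv (P : Type u) (Q : Type v) [Preorder P] [Preorder Q] : Prop :=
  TukeyLE P Q ∧ TukeyLE Q P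

/-- The neighborhood filter of `a` as a directed set, ordered by containment: `M ≤ N` iff
`N ⊆ M`. -/
abbrev NhdsOrder {X : Type u} [TopologicalSpace X] (a : X) : Type u :=
  {N : Set X // N ∈ 𝓝 a}ᵒᵈ

/-! Every point `x` of `K` admits a continuous surjection `φ` of `K` onto `(ω + 1) × (ω₁ + 1)` whose
fibre over the corner `(ω, ω₁)` is `{x}`. As `K` is compact, the neighborhood filter of `x` is the
pullback of that of the corner, hence `x` has Tukey type `ω × ω₁` and `π`-character at most `ω₁`.
If `φ` and `ψ` are such surjections for `x` and `y`, then in the closed relation `φ a = ψ b` the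
point `x` is related to `y` alone and conversely, so the shift on the bi-infinite chains of this
relation makes `x` and `y` pin equivalent.

To construct `φ`, approach `f ∈ 2^{ω₁}_lex` from below through clopen initial segments, one for each
coordinate where `f` is `1`, and from above through final segments, one for each coordinate where
`f` is `0`. At least one of these two sets of coordinates is cofinal in `ω₁`. On that side the
clopen sets form an increasing sequence of length `ω₁`, which yields the map onto `ω₁ + 1`. On the
other side they are countably many, or again cofinal; the map onto `ω + 1` coming from `2^ω` absorbs
the countable case.

The `π`-character is `ω` over the supremum of a strictly increasing sequence in `2^{ω₁}_lex`, and
`ω₁` over the largest element, where countably many neighborhoods intersect in a neighborhood. -/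

section PiCharacter

variable {X Y : Type u} [TopologicalSpace X] [TopologicalSpace Y] {x : X} {y : Y}

theorem isLocalPiBase_setOf_isOpen (x : X) : IsLocalPiBase x {U : Set X | IsOpen U ∧ U.Nonempty} :=
  ⟨fun _ hU => hU, fun N hN => ⟨interior N,
    ⟨isOpen_interior, x, mem_interior_iff_mem_nhds.2 hN⟩, interior_subset⟩⟩

theorem exists_isLocalPiBase_mk_eq_piCharacter (x : X) :
    ∃ F : Set (Set X), IsLocalPiBase x F ∧ #F = piCharacter x :=
  csInf_mem (s := {κ | ∃ F : Set (Set X), IsLocalPiBase x F ∧ #F = κ})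
    ⟨_, _, isLocalPiBase_setOf_isOpen x, rfl⟩

theorem IsLocalPiBase.piCharacter_le {F : Set (Set X)} (hF : IsLocalPiBase x F) :
    piCharacter x ≤ #F :=
  csInf_le' ⟨F, hF, rfl⟩

theorem piCharacter_le_of_forall_mem_nhds {ι : Type u} {U : ι → Set X}
    (hU : ∀ i, IsOpen (U i) ∧ (U i).Nonempty) (h : ∀ N ∈ 𝓝 x, ∃ i, U i ⊆ N) :
    piCharacter x ≤ #ι := by
  have hF : IsLocalPiBase x (Set.range U) := ⟨Set.forall_mem_range.2 hU, by simpa using h⟩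
  exact hF.piCharacter_le.trans Cardinal.mk_range_le

theorem piCharacter_le_of_hasBasis {ι : Type u} {s : ι → Set X}
    (h : (𝓝 x).HasBasis (fun _ => True) s) : piCharacter x ≤ #ι :=
  piCharacter_le_of_forall_mem_nhds
    (fun _ => ⟨isOpen_interior, x, mem_interior_iff_mem_nhds.2 (h.mem_of_mem trivial)⟩)
    fun _ hN => (h.mem_iff.1 hN).imp fun _ hi => interior_subset.trans hi.2

theorem piCharacter_le_of_isOpenMap {f : X → Y} (hf : IsOpenMap f) (hx : ContinuousAt f x) :
    piCharacter (f x) ≤ piCharacter x := by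
  obtain ⟨F, hF, hcard⟩ := exists_isLocalPiBase_mk_eq_piCharacter x
  have himage : IsLocalPiBase (f x) (Set.image f '' F) := by
    refine ⟨?_, fun N hN => ?_⟩
    · rintro _ ⟨U, hU, rfl⟩
      exact ⟨hf U (hF.1 U hU).1, (hF.1 U hU).2.image f⟩
    · obtain ⟨U, hU, hUN⟩ := hF.2 _ (hx hN)
      exact ⟨f '' U, ⟨U, hU, rfl⟩, Set.image_subset_iff.2 hUN⟩
  exact hcard ▸ himage.piCharacter_le.trans Cardinal.mk_image_le

theorem piCharacter_prod_le (x : X) (y : Y) :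
    piCharacter (x, y) ≤ piCharacter x * piCharacter y := by
  obtain ⟨F, hF, hcardF⟩ := exists_isLocalPiBase_mk_eq_piCharacter x
  obtain ⟨G, hG, hcardG⟩ := exists_isLocalPiBase_mk_eq_piCharacter y
  rw [← hcardF, ← hcardG, Cardinal.mul_def]
  refine piCharacter_le_of_forall_mem_nhds (U := fun q : F × G => q.1.1 ×ˢ q.2.1)
    (fun ⟨⟨U, hU⟩, ⟨V, hV⟩⟩ => ⟨(hF.1 U hU).1.prod (hG.1 V hV).1, (hF.1 U hU).2.prod (hG.1 V hV).2⟩)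
    fun N hN => ?_
  obtain ⟨M, hM, M', hM', hMN⟩ := mem_nhds_prod_iff.1 hN
  obtain ⟨U, hU, hUM⟩ := hF.2 M hM
  obtain ⟨V, hV, hVM⟩ := hG.2 M' hM'
  exact ⟨(⟨U, hU⟩, ⟨V, hV⟩), (Set.prod_mono hUM hVM).trans hMN⟩

theorem piCharacter_le_aleph0 [FirstCountableTopology X] (x : X) : piCharacter x ≤ ℵ₀ := by
  obtain ⟨s, hs⟩ := (𝓝 x).exists_antitone_basis
  have hs' : (𝓝 x).HasBasis (fun _ : ULift.{u} ℕ => True) fun n => s n.down :=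
    hs.toHasBasis.to_hasBasis (fun n _ => ⟨⟨n⟩, trivial, subset_rfl⟩)
      fun n _ => ⟨n.down, trivial, subset_rfl⟩
  simpa using piCharacter_le_of_hasBasis hs'

/- If `F` were a smaller local `π`-base, pick a point other than `x` in each member of `F`:
deleting these fewer than `κ` points leaves a neighborhood of `x` that contains no member of `F`. -/
theorem le_piCharacter [T1Space X] (x : X) [(𝓝[≠] x).NeBot] (κ : Cardinal.{u})
    [CardinalInterFilter (𝓝 x) κ] : κ ≤ piCharacter x := by
  obtain ⟨F, hF, hcard⟩ := exists_isLocalPiBase_mk_eq_piCharacter x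
  by_contra! hlt
  have hexists (U : F) : ∃ y ∈ U.1, y ≠ x := by
    by_contra! hU
    obtain ⟨y, hy⟩ := (hF.1 U U.2).2
    have hUx : U.1 = {x} := Set.eq_singleton_iff_nonempty_unique_mem.2 ⟨⟨y, hy⟩, hU⟩
    exact not_isOpen_singleton x (hUx ▸ (hF.1 U U.2).1)
  choose y hyU hyx using hexists
  have hmem : ⋂ U : F, {y U}ᶜ ∈ 𝓝 x :=
    (Filter.cardinal_iInter_mem (hcard ▸ hlt)).2 fun U =>
      isOpen_compl_singleton.mem_nhds (hyx U).symm
  obtain ⟨U, hU, hUN⟩ := hF.2 _ hmem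
  exact Set.mem_iInter.1 (hUN (hyU ⟨U, hU⟩)) ⟨U, hU⟩ rfl

theorem aleph0_le_piCharacter [T1Space X] (x : X) [(𝓝[≠] x).NeBot] : ℵ₀ ≤ piCharacter x :=
  have := (𝓝 x).cardinalInterFilter_aleph0
  le_piCharacter x ℵ₀

theorem piCharacter_le_aleph0_of_isLUB [LinearOrder X] [OrderTopology X] {a : ℕ → X}
    (ha : StrictMono a) (hx : IsLUB (Set.range a) x) : piCharacter x ≤ ℵ₀ := by
  have h := piCharacter_le_of_forall_mem_nhds (x := x) (ι := ULift.{u} ℕ)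
    (U := fun n => Set.Ioo (a n.down) (a (n.down + 2)))
    (fun n => ⟨isOpen_Ioo, a (n.down + 1), ha (by lia), ha (by lia)⟩) fun N hN => ?_
  · simpa using h
  · have hlt (n : ℕ) : a n < x := (ha n.lt_succ_self).trans_le (hx.1 ⟨_, rfl⟩)
    obtain ⟨l, hl, hlN⟩ := exists_Ioc_subset_of_mem_nhds hN ⟨a 0, hlt 0⟩
    obtain ⟨_, ⟨n, rfl⟩, hn, -⟩ := hx.exists_between hl
    exact ⟨⟨n⟩, fun z hz => hlN ⟨hn.trans hz.1, (hz.2.trans (hlt _)).le⟩⟩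

end PiCharacter

theorem tukeyEquiv_of_hasBasis {X : Type u} [TopologicalSpace X] {x : X} {P : Type v} [Preorder P]
    {s : P → Set X} (hs : (𝓝 x).HasBasis (fun _ => True) s) (hsub : ∀ p q, s p ⊆ s q ↔ q ≤ p) :
    TukeyEquiv (NhdsOrder x) P := by
  let S (p : P) : NhdsOrder x := OrderDual.toDual ⟨s p, hs.mem_of_mem trivial⟩
  have hcofinal (N : NhdsOrder x) : ∃ p, N ≤ S p :=
    (hs.mem_iff.1 (OrderDual.ofDual N).2).imp fun _ hp => hp.2
  have hle {p q : P} : S q ≤ S p ↔ q ≤ p := hsub p q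
  choose r hr using hcofinal
  exact ⟨⟨S, fun N => ⟨r N, fun p hp => (hr N).trans (hle.2 hp)⟩⟩,
    ⟨r, fun p => ⟨S p, fun N hN => hle.1 (hN.trans (hr N))⟩⟩⟩

theorem exists_int_chain {X : Type*} {R : X → X → Prop} (hright : ∀ y, ∃ z, R y z)
    (hleft : ∀ z, ∃ y, R y z) (y : X) : ∃ s : ℤ → X, s 0 = y ∧ ∀ k, R (s k) (s (k + 1)) := by
  choose r hr using hright
  choose l hl using hleft
  refine ⟨fun k => match k with
    | Int.ofNat n => r^[n] y
    | Int.negSucc n => l^[n + 1] y, rfl, fun k => ?_⟩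
  match k with
  | Int.ofNat n =>
    change R (r^[n] y) (r^[n + 1] y)
    exact (Function.iterate_succ_apply' r n y).symm ▸ hr (r^[n] y)
  | Int.negSucc 0 => exact hl y
  | Int.negSucc (n + 1) =>
    change R (l^[n + 1 + 1] y) (l^[n + 1] y)
    exact (Function.iterate_succ_apply' l (n + 1) y).symm ▸ hl (l^[n + 1] y)

/- The pinning space consists of the bi-infinite `R`-chains; its homeomorphism is the shift. -/
theorem pinEquivSets_of_isClosed {X : Type u} [TopologicalSpace X] [CompactSpace X] [T2Space X]
    {A B : Set X} {R : Set (X × X)} (hclosed : IsClosed R) (hright : ∀ y, ∃ z, (y, z) ∈ R)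
    (hleft : ∀ z, ∃ y, (y, z) ∈ R) (hAB : ∀ y z, (y, z) ∈ R → (y ∈ A ↔ z ∈ B)) :
    PinEquivSets A B := by
  let S : Set (ℤ → X) := {s | ∀ k, (s k, s (k + 1)) ∈ R}
  have hS : IsClosed S := by
    simp only [S, Set.ofPred_forall]
    exact isClosed_iInter fun k => hclosed.preimage (by fun_prop)
  have hval : Continuous ((↑) : S → ℤ → X) := continuous_subtype_val
  let shift : S ≃ₜ S :=
    { toFun := fun s => ⟨fun k => s.1 (k + 1), fun k => s.2 (k + 1)⟩
      invFun := fun s => ⟨fun k => s.1 (k - 1), fun k => by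
        simpa only [sub_add_cancel, add_sub_cancel_right] using s.2 (k - 1)⟩
      left_inv := fun s => by ext k; simp
      right_inv := fun s => by ext k; simp
      continuous_toFun := Continuous.subtype_mk
        (continuous_pi fun k => (continuous_apply (k + 1)).comp hval) _
      continuous_invFun := Continuous.subtype_mk
        (continuous_pi fun k => (continuous_apply (k - 1)).comp hval) _ }
  refine ⟨S, inferInstance, isCompact_iff_compactSpace.1 hS.isCompact, inferInstance,
    fun s => s.1 0, shift, (continuous_apply 0).comp continuous_subtype_val, fun y => ?_, ?_⟩
  · obtain ⟨s, hs0, hs⟩ := exists_int_chain hright hleft y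
    exact ⟨⟨s, hs⟩, hs0⟩
  · ext s
    rw [← Homeomorph.coe_toEquiv, Equiv.image_eq_preimage_symm]
    exact hAB (s.1 (0 - 1)) (s.1 0) (by simpa only [sub_add_cancel] using s.2 (0 - 1))

/-- A continuous surjection `φ : X → Z` whose fibre over `z` is the single point `x`. Through such
a map, `x` inherits the local topology of `z`. -/
structure IsPinnedSurjection {X : Type u} {Z : Type v} [TopologicalSpace X] [TopologicalSpace Z]
    (φ : X → Z) (x : X) (z : Z) : Prop where
  continuous : Continuous φ
  surjective : Function.Surjective φ
  apply_eq_iff : ∀ y, φ y = z ↔ y = x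

namespace IsPinnedSurjection

variable {X : Type u} {Z : Type v} [TopologicalSpace X] [CompactSpace X]
  [TopologicalSpace Z] [T2Space Z] {φ ψ : X → Z} {x y : X} {z : Z}

theorem nhds_eq_comap (h : IsPinnedSurjection φ x z) : 𝓝 x = Filter.comap φ (𝓝 z) := by
  have hfibre : φ ⁻¹' {z} = {x} := Set.ext h.apply_eq_iff
  rw [h.continuous.isClosedMap.comap_nhds_eq h.continuous, hfibre, nhdsSet_singleton]

theorem neBot_nhdsNE (h : IsPinnedSurjection φ x z) [(𝓝[≠] z).NeBot] : (𝓝[≠] x).NeBot := by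
  have hcompl : ({x}ᶜ : Set X) = φ ⁻¹' {z}ᶜ := by ext y; simp [h.apply_eq_iff]
  rw [nhdsWithin, h.nhds_eq_comap, hcompl, ← Filter.comap_principal, ← Filter.comap_inf]
  exact Filter.NeBot.comap_of_surj ‹_› h.surjective

theorem pinEquiv [T2Space X] (hx : IsPinnedSurjection φ x z) (hy : IsPinnedSurjection ψ y z) :
    PinEquiv x y := by
  refine pinEquivSets_of_isClosed (R := {p | φ p.1 = ψ p.2})
    (isClosed_eq (hx.continuous.comp continuous_fst) (hy.continuous.comp continuous_snd))
    (fun a => (hy.surjective (φ a)).imp fun _ => Eq.symm) (fun b => hx.surjective (ψ b))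
    fun a b (hab : φ a = ψ b) => ?_
  simp only [Set.mem_singleton_iff, ← hx.apply_eq_iff, ← hy.apply_eq_iff, hab]

theorem hasBasis {ι : Type*} {s : ι → Set Z} (h : IsPinnedSurjection φ x z)
    (hs : (𝓝 z).HasBasis (fun _ => True) s) :
    (𝓝 x).HasBasis (fun _ => True) fun i => φ ⁻¹' s i :=
  h.nhds_eq_comap ▸ hs.comap φ

theorem tukeyEquiv {P : Type*} [Preorder P] {s : P → Set Z} (h : IsPinnedSurjection φ x z)
    (hs : (𝓝 z).HasBasis (fun _ => True) s) (hsub : ∀ p q, s p ⊆ s q ↔ q ≤ p) :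
    TukeyEquiv (NhdsOrder x) P :=
  tukeyEquiv_of_hasBasis (h.hasBasis hs) fun p q =>
    h.surjective.preimage_subset_preimage_iff.trans (hsub p q)

end IsPinnedSurjection

section WithTop

variable {ι : Type u} [LinearOrder ι] [TopologicalSpace ι] [OrderTopology ι]

theorem hasBasis_nhds_withTop_top [Nonempty ι] :
    (𝓝 (⊤ : WithTop ι)).HasBasis (fun _ : ι => True) fun i => Set.Ioi (i : WithTop ι) :=
  nhds_top_basis.to_hasBasis
    (fun a ha => ⟨a.untop ha.ne, trivial, by simp⟩)
    fun i _ => ⟨i, WithTop.coe_lt_top i, subset_rfl⟩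

instance [Nonempty ι] [NoMaxOrder ι] : (𝓝[≠] (⊤ : WithTop ι)).NeBot :=
  (tendsto_nhdsWithin_iff.2 ⟨WithTop.tendsto_coe_atTop,
    .of_forall fun _ => WithTop.coe_ne_top⟩).neBot

instance [Nonempty ι] : CardinalInterFilter (𝓝 (⊤ : WithTop ι)) (Order.cof ι) where
  cardinal_sInter_mem S hcard hS := by
    choose! i _ hi using fun N hN => hasBasis_nhds_withTop_top.mem_iff.1 (hS N hN)
    have hbdd : ¬ IsCofinal (i '' S) := fun hcof =>
      ((Order.cof_le hcof).trans Cardinal.mk_image_le).not_gt hcard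
    obtain ⟨b, hb⟩ := not_isCofinal_iff.1 hbdd
    refine Filter.mem_of_superset (hasBasis_nhds_withTop_top.mem_of_mem (i := b) trivial)
      fun y hy N hN => hi N hN ?_
    exact (WithTop.coe_lt_coe.2 (hb _ ⟨N, hN, rfl⟩)).trans hy

theorem IsPinnedSurjection.cof_le_piCharacter [Nonempty ι] [NoMaxOrder ι] {X : Type u}
    [TopologicalSpace X] [CompactSpace X] [T1Space X] {q : X → WithTop ι} {x : X}
    (h : IsPinnedSurjection q x ⊤) : Order.cof ι ≤ piCharacter x :=
  have := h.neBot_nhdsNE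
  have : CardinalInterFilter (𝓝 x) (Order.cof ι) := h.nhds_eq_comap ▸ inferInstance
  le_piCharacter x _

end WithTop

instance {X Y : Type*} [TopologicalSpace X] [TopologicalSpace Y] (x : X) (y : Y)
    [(𝓝[≠] x).NeBot] : (𝓝[≠] (x, y)).NeBot := by
  have hmaps : Set.MapsTo (fun z => (z, y)) {x}ᶜ {(x, y)}ᶜ := fun _ hz h => hz (congrArg Prod.fst h)
  exact ((Continuous.prodMk_left y).continuousWithinAt.tendsto_nhdsWithin hmaps).neBot

section CornerBox

variable {ι κ : Type*} [LinearOrder ι] [LinearOrder κ]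

/-- The box of points of `(ι ∪ {⊤}) × (κ ∪ {⊤})` lying above `p` in both coordinates. These boxes
are the basic neighborhoods of the corner `(⊤, ⊤)`. -/
def cornerBox (p : ι × κ) : Set (WithTop ι × WithTop κ) :=
  Set.Ioi (p.1 : WithTop ι) ×ˢ Set.Ioi (p.2 : WithTop κ)

theorem cornerBox_subset_cornerBox_iff {p q : ι × κ} : cornerBox p ⊆ cornerBox q ↔ q ≤ p := by
  have hne : (cornerBox p).Nonempty := ⟨(⊤, ⊤), by simp [cornerBox]⟩
  rw [cornerBox, cornerBox, Set.prod_subset_prod_iff' hne, Set.Ioi_subset_Ioi_iff,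
    Set.Ioi_subset_Ioi_iff, WithTop.coe_le_coe, WithTop.coe_le_coe, Prod.le_def]

theorem hasBasis_cornerBox [Nonempty ι] [TopologicalSpace ι] [OrderTopology ι] [Nonempty κ]
    [TopologicalSpace κ] [OrderTopology κ] :
    (𝓝 ((⊤, ⊤) : WithTop ι × WithTop κ)).HasBasis (fun _ => True) cornerBox := by
  simpa only [and_self, ← cornerBox.eq_def] using
    hasBasis_nhds_withTop_top (ι := ι) |>.prod_nhds (hasBasis_nhds_withTop_top (ι := κ))

end CornerBox

section EntryLevel

variable {X : Type*} {ι : Type*} [LinearOrder ι] [WellFoundedLT ι] {B : ι → Set X} {y : X} {i : ι}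

open Classical in
/-- The least index `i` with `y ∈ B i`, or `⊤` if there is none. For an increasing family `B` of
clopen sets it is continuous in `y`. -/
noncomputable def entryLevel (B : ι → Set X) (y : X) : WithTop ι :=
  if h : ∃ i, y ∈ B i then (wellFounded_lt.min {i | y ∈ B i} h : ι) else ⊤

theorem entryLevel_le_coe_iff (hB : Monotone B) : entryLevel B y ≤ i ↔ y ∈ B i := by
  unfold entryLevel
  split_ifs with h
  · rw [WithTop.coe_le_coe]
    exact ⟨fun hi => hB hi (wellFounded_lt.min_mem {i : ι | y ∈ B i} h),
      fun hi => wellFounded_lt.min_le (s := {i : ι | y ∈ B i}) hi⟩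
  · simpa using not_exists.1 h i

theorem entryLevel_eq_top_iff (hB : Monotone B) : entryLevel B y = ⊤ ↔ y ∉ ⋃ i, B i := by
  rw [WithTop.eq_top_iff_forall_gt (x := entryLevel B y)]
  simp only [Set.mem_iUnion, not_exists, ← entryLevel_le_coe_iff hB, not_le]

theorem entryLevel_eq_coe (hB : Monotone B) (hi : y ∈ B i) (hlt : ∀ j < i, y ∉ B j) :
    entryLevel B y = i := by
  refine ((entryLevel_le_coe_iff hB).2 hi).antisymm (le_of_not_gt fun h => ?_)
  obtain ⟨j, hj⟩ := WithTop.ne_top_iff_exists.1 h.ne_top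
  exact hlt j (WithTop.coe_lt_coe.1 (hj ▸ h)) ((entryLevel_le_coe_iff hB).1 hj.ge)

theorem continuous_entryLevel [TopologicalSpace X] [TopologicalSpace ι] [OrderTopology ι]
    (hB : Monotone B) (hclopen : ∀ i, IsClopen (B i)) : Continuous (entryLevel B) := by
  refine OrderTopology.continuous_iff.2 fun a => ⟨?_, ?_⟩
  · induction a using WithTop.recTopCoe with
    | top => simp
    | coe i =>
      have : entryLevel B ⁻¹' Set.Ioi (i : WithTop ι) = (B i)ᶜ := by
        ext y; simp [← entryLevel_le_coe_iff hB]
      exact this ▸ (hclopen i).compl.isOpen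
  · have : entryLevel B ⁻¹' Set.Iio a = ⋃ i : ι, ⋃ _ : (i : WithTop ι) < a, B i := by
      ext y
      simp only [Set.mem_preimage, Set.mem_Iio, Set.mem_iUnion, exists_prop,
        ← entryLevel_le_coe_iff hB]
      refine ⟨fun h => ?_, fun ⟨i, hi, hy⟩ => hy.trans_lt hi⟩
      obtain ⟨i, hi⟩ := WithTop.ne_top_iff_exists.1 h.ne_top
      exact ⟨i, hi ▸ h, hi.ge⟩
    exact this ▸ isOpen_iUnion fun i => isOpen_iUnion fun _ => (hclopen i).isOpen

end EntryLevel

theorem exists_continuous_withTop_nat_eq_top_iff {X : Type*} [TopologicalSpace X] {J : Type*}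
    [Countable J] {C : J → Set X} (hC : ∀ j, IsClopen (C j)) :
    ∃ p : X → WithTop ℕ, Continuous p ∧ ∀ y, p y = ⊤ ↔ y ∉ ⋃ j, C j := by
  cases nonempty_encodable J
  let D (n : ℕ) : Set X := ⋃ j ∈ Encodable.decode₂ J n, C j
  have hD (n : ℕ) : IsClopen (D n) :=
    Encodable.iUnion_decode₂_cases (C := IsClopen) isClopen_empty hC
  refine ⟨entryLevel (Set.accumulate D), continuous_entryLevel Set.monotone_accumulate fun n =>
    (Set.finite_Iic n).isClopen_biUnion fun m _ => hD m, fun y => ?_⟩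
  rw [entryLevel_eq_top_iff Set.monotone_accumulate, Set.iUnion_accumulate,
    Encodable.iUnion_decode₂]

theorem isClopen_Iio_of_covBy {α : Type*} [LinearOrder α] [TopologicalSpace α] [OrderTopology α]
    {a b : α} (h : a ⋖ b) : IsClopen (Set.Iio b) :=
  ⟨h.Iio_eq ▸ isClosed_Iic, isOpen_Iio⟩

theorem exists_continuous_withTop_eq_top_iff_le {α ι : Type*} [LinearOrder α] [TopologicalSpace α]
    [OrderTopology α] [LinearOrder ι] [WellFoundedLT ι] [TopologicalSpace ι] [OrderTopology ι]
    {c d : ι → α} {a : α} (hd : StrictMono d) (hcov : ∀ i, c i ⋖ d i)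
    (ha : ∀ x, x < a ↔ ∃ i, x < d i) :
    ∃ q : α → WithTop ι, Continuous q ∧ Function.Surjective q ∧ ∀ x, q x = ⊤ ↔ a ≤ x := by
  have hmono : Monotone fun i => Set.Iio (d i) := fun _ _ hij =>
    Set.Iio_subset_Iio (hd.monotone hij)
  have htop (x : α) : entryLevel (fun i => Set.Iio (d i)) x = ⊤ ↔ a ≤ x := by
    rw [entryLevel_eq_top_iff hmono, ← not_lt, ha, Set.mem_iUnion]
    rfl
  refine ⟨_, continuous_entryLevel hmono fun i => isClopen_Iio_of_covBy (hcov i),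
    fun t => ?_, htop⟩
  induction t using WithTop.recTopCoe with
  | top => exact ⟨a, (htop a).2 le_rfl⟩
  | coe i =>
    exact ⟨c i, entryLevel_eq_coe hmono (hcov i).lt fun j hj =>
      ((hcov i).le_of_lt (hd hj)).not_gt⟩

section Pi

variable {E : ℕ → Type*} [∀ n, TopologicalSpace (E n)] [∀ n, DiscreteTopology (E n)]

theorem isClopen_cylinder (c : ∀ n, E n) (n : ℕ) : IsClopen (PiNat.cylinder c n) := by
  rw [PiNat.cylinder_eq_pi]
  exact ⟨isClosed_set_pi fun _ _ => isClosed_discrete _,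
    isOpen_set_pi (Finset.finite_toSet _) fun _ _ => isOpen_discrete _⟩

theorem exists_isPinnedSurjection_pi_nat [∀ n, Nontrivial (E n)] (c : ∀ n, E n) :
    ∃ δ : (∀ n, E n) → WithTop ℕ, IsPinnedSurjection δ c ⊤ := by
  have hmono : Monotone fun n => (PiNat.cylinder c (n + 1))ᶜ := fun m n hmn =>
    Set.compl_subset_compl.2 (PiNat.cylinder_anti c (by lia))
  have htop (d) : entryLevel (fun n => (PiNat.cylinder c (n + 1))ᶜ) d = ⊤ ↔ d = c := by
    rw [entryLevel_eq_top_iff hmono]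
    simp only [Set.mem_iUnion, Set.mem_compl_iff, not_exists, not_not, PiNat.mem_cylinder_iff]
    exact ⟨fun h => funext fun n => h n n n.lt_succ_self, fun h _ _ _ => h ▸ rfl⟩
  refine ⟨_, continuous_entryLevel hmono fun n => (isClopen_cylinder c _).compl, fun t => ?_, htop⟩
  induction t using WithTop.recTopCoe with
  | top => exact ⟨c, (htop c).2 rfl⟩
  | coe n =>
    obtain ⟨e, he⟩ := exists_ne (c n)
    refine ⟨Function.update c n e, entryLevel_eq_coe hmono
      (fun h => he ?_) fun m hm => not_not.2 ?_⟩
    · simpa using PiNat.mem_cylinder_iff.1 h n n.lt_succ_self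
    · exact PiNat.cylinder_anti c hm (PiNat.update_mem_cylinder c n e)

end Pi

/-- The well-ordered set of countable ordinals, whose order type is `ω₁`. -/
abbrev CountableOrdinal : Type := (ω₁ : Ordinal.{0}).ToType

namespace CountableOrdinal

noncomputable instance : TopologicalSpace CountableOrdinal := Preorder.topology _

instance : OrderTopology CountableOrdinal := ⟨rfl⟩

instance : IsRegularCardinalOrder CountableOrdinal := ⟨by simp⟩

instance : NoMaxOrder CountableOrdinal :=
  Ordinal.isSuccPrelimit_type_lt_iff.1 <| by
    simpa using (Cardinal.isSuccLimit_omega 1).isSuccPrelimit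

instance : Nonempty CountableOrdinal :=
  Ordinal.nonempty_toType_iff.2 (Ordinal.omega_pos 1).ne'

theorem mk_eq_aleph_one : #CountableOrdinal = ℵ₁ := by simp

theorem countable_Iio (a : CountableOrdinal) : (Set.Iio a).Countable := by
  rw [← Cardinal.le_aleph0_iff_set_countable, ← Order.lt_succ_iff, Cardinal.succ_aleph0,
    ← mk_eq_aleph_one]
  exact Cardinal.mk_Iio_lt a (by simp)

theorem countable_of_not_isCofinal {s : Set CountableOrdinal} (hs : ¬ IsCofinal s) :
    s.Countable := by
  obtain ⟨a, ha⟩ := not_isCofinal_iff.1 hs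
  exact (countable_Iio a).mono ha

end CountableOrdinal

theorem isCofinal_or_isCofinal_compl {ι : Type*} [LinearOrder ι] (s : Set ι) :
    IsCofinal s ∨ IsCofinal sᶜ := by
  by_contra! h
  obtain ⟨a, ha⟩ := not_isCofinal_iff.1 h.1
  obtain ⟨b, hb⟩ := not_isCofinal_iff.1 h.2
  by_cases hmem : max a b ∈ s
  · exact (ha _ hmem).not_ge (le_max_left a b)
  · exact (hb _ hmem).not_ge (le_max_right a b)

namespace LexPower

section Order

variable {α : Ordinal.{0}} {f g : LexPower α} {b : Bool} {β γ : α.ToType}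

@[ext] theorem ext (h : ∀ β, f β = g β) : f = g := funext h

/-- The point of `2^α_lex` given by a function on the ordinals below `α`. -/
def ofFun (h : α.ToType → Bool) : LexPower α := toLex h

@[simp] theorem ofFun_apply (h : α.ToType → Bool) (β : α.ToType) : ofFun h β = h β := rfl

noncomputable instance : CompactSpace (LexPower α) :=
  @compactSpace_of_completeLinearOrder (LexPower α)
    (inferInstanceAs (CompleteLinearOrder (Lex (α.ToType → Bool)))) _ ⟨rfl⟩

theorem exists_isLUB (s : Set (LexPower α)) : ∃ f, IsLUB s f :=
  ⟨_, @isLUB_sSup (Lex (α.ToType → Bool)) _ s⟩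

theorem lt_iff : f < g ↔ ∃ β, (∀ γ < β, f γ = g γ) ∧ f β = false ∧ g β = true :=
  exists_congr fun _ => and_congr_right fun _ => Bool.lt_iff

theorem le_of_forall_apply_le (h : ∀ β, f β ≤ g β) : f ≤ g :=
  Pi.toLex_monotone (β := fun _ : α.ToType => Bool) h

/-- The function that agrees with `f` below `γ`, takes the value `b` at `γ` and is constantly `!b`
above `γ`. -/
noncomputable def cut (f : LexPower α) (b : Bool) (γ : α.ToType) : LexPower α :=
  ofFun fun β => if β < γ then f β else if β = γ then b else !b

theorem cut_apply_of_lt (h : β < γ) : cut f b γ β = f β := by simp [cut, h]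

@[simp] theorem cut_apply_self : cut f b γ γ = b := by simp [cut]

theorem cut_apply_of_gt (h : γ < β) : cut f b γ β = !b := by simp [cut, h.not_gt, h.ne']

theorem cut_apply_of_le (hγ : f γ = b) (h : β ≤ γ) : cut f b γ β = f β := by
  rcases h.lt_or_eq with hlt | rfl
  · exact cut_apply_of_lt hlt
  · rw [cut_apply_self, hγ]

theorem cut_false_lt_cut_true (f : LexPower α) (γ : α.ToType) : cut f false γ < cut f true γ :=
  lt_iff.2 ⟨γ, fun _ h => by rw [cut_apply_of_lt h, cut_apply_of_lt h], cut_apply_self,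
    cut_apply_self⟩

theorem le_cut_false_of_lt_cut_true (h : g < cut f true γ) : g ≤ cut f false γ := by
  obtain ⟨β, heq, hg, hcut⟩ := lt_iff.1 h
  rcases lt_trichotomy β γ with hβ | rfl | hβ
  · rw [cut_apply_of_lt hβ] at hcut
    refine (lt_iff.2 ⟨β, fun δ hδ => ?_, hg, ?_⟩).le
    · rw [heq δ hδ, cut_apply_of_lt (hδ.trans hβ), cut_apply_of_lt (hδ.trans hβ)]
    · rw [cut_apply_of_lt hβ, hcut]
  · refine le_of_forall_apply_le fun δ => ?_
    rcases lt_trichotomy δ β with hδ | rfl | hδ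
    · rw [heq δ hδ, cut_apply_of_lt hδ, cut_apply_of_lt hδ]
    · simp [hg]
    · simp [cut_apply_of_gt hδ, Bool.le_true]
  · simp [cut_apply_of_gt hβ] at hcut

theorem cut_false_covBy_cut_true (f : LexPower α) (γ : α.ToType) : cut f false γ ⋖ cut f true γ :=
  ⟨cut_false_lt_cut_true f γ, fun _ hlt hgt => (le_cut_false_of_lt_cut_true hgt).not_gt hlt⟩

theorem cut_true_le_self (hγ : f γ = true) : cut f true γ ≤ f := by
  refine le_of_forall_apply_le fun β => ?_
  rcases le_or_gt β γ with hβ | hβ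
  · exact (cut_apply_of_le hγ hβ).le
  · simp [cut_apply_of_gt hβ]

theorem cut_true_lt_cut_true (hβ : f β = true) (h : β < γ) : cut f true β < cut f true γ := by
  refine lt_of_le_of_ne (le_of_forall_apply_le fun δ => ?_) fun heq => ?_
  · rcases le_or_gt δ β with hδ | hδ
    · rw [cut_apply_of_le hβ hδ, cut_apply_of_lt (hδ.trans_lt h)]
    · simp [cut_apply_of_gt hδ]
  · simpa [cut_apply_of_gt h] using congrFun heq γ

theorem lt_iff_exists_lt_cut_true : g < f ↔ ∃ γ : {γ // f γ = true}, g < cut f true γ := by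
  refine ⟨fun h => ?_, fun ⟨γ, h⟩ => h.trans_le (cut_true_le_self γ.2)⟩
  obtain ⟨γ, heq, hg, hf⟩ := lt_iff.1 h
  exact ⟨⟨γ, hf⟩, lt_iff.2 ⟨γ, fun β hβ => (heq β hβ).trans (cut_apply_of_lt hβ).symm, hg,
    cut_apply_self⟩⟩

/-- The indicator function of the ordinals below `β`, as a point of `2^α_lex`. -/
noncomputable def indicatorIio (β : α.ToType) : LexPower α := ofFun fun γ => decide (γ < β)

theorem strictMono_indicatorIio : StrictMono (indicatorIio (α := α)) := by
  intro β γ h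
  refine lt_of_le_of_ne (le_of_forall_apply_le fun δ => ?_) fun heq => ?_
  · simpa [indicatorIio, Bool.le_iff_imp] using fun hδ : δ < β => hδ.trans h
  · simpa [indicatorIio, h] using congrFun heq β

/-- The pointwise complement, which reverses the lexicographic order. -/
def compl (f : LexPower α) : LexPower α := ofFun fun β => !f β

@[simp] theorem compl_apply (f : LexPower α) (β : α.ToType) : compl f β = !f β := rfl

@[simp] theorem compl_compl (f : LexPower α) : compl (compl f) = f :=
  ext fun β => Bool.not_not (f β)

theorem compl_lt_compl : compl f < compl g ↔ g < f := by
  simp only [lt_iff, compl_apply, Bool.not_inj_iff, Bool.not_eq_false', Bool.not_eq_true',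
    eq_comm (a := f _), and_comm (a := true = f _)]

theorem compl_le_compl : compl f ≤ compl g ↔ g ≤ f := by
  rw [← not_lt, compl_lt_compl, not_lt]

theorem continuous_compl : Continuous (compl (α := α)) := by
  let e : LexPower α ≃o (LexPower α)ᵒᵈ :=
    { toFun := fun f => OrderDual.toDual (compl f)
      invFun := fun f => compl (OrderDual.ofDual f)
      left_inv := compl_compl
      right_inv := compl_compl
      map_rel_iff' := compl_le_compl }
  exact continuous_ofDual.comp e.continuous

end Order

section Level

theorem exists_continuous_nat_eq_top_iff_le {α : Ordinal.{0}} {f : LexPower α}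
    (hf : {β | f β = true}.Countable) :
    ∃ p : LexPower α → WithTop ℕ, Continuous p ∧ ∀ g, p g = ⊤ ↔ f ≤ g := by
  have := hf.to_subtype
  obtain ⟨p, hp, htop⟩ := exists_continuous_withTop_nat_eq_top_iff
    fun β : {β | f β = true} => isClopen_Iio_of_covBy (cut_false_covBy_cut_true f β)
  refine ⟨p, hp, fun g => ?_⟩
  rw [htop, ← not_lt, lt_iff_exists_lt_cut_true, Set.mem_iUnion]
  rfl

theorem exists_continuous_countableOrdinal_eq_top_iff_le {f : LexPower ω₁}
    (hf : IsCofinal {β | f β = true}) :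
    ∃ q : LexPower ω₁ → WithTop CountableOrdinal,
      Continuous q ∧ Function.Surjective q ∧ ∀ g, q g = ⊤ ↔ f ≤ g := by
  let e := Order.enum {β : CountableOrdinal | f β = true} hf
  have hmono : StrictMono fun i => cut f true (e i) := fun i j hij =>
    cut_true_lt_cut_true (e i).2 (e.lt_iff_lt.2 hij)
  refine exists_continuous_withTop_eq_top_iff_le hmono
    (fun i => cut_false_covBy_cut_true f (e i)) fun g => ?_
  rw [lt_iff_exists_lt_cut_true]
  exact (e.surjective.exists (p := fun γ => g < cut f true γ))

theorem exists_continuous_pair_eq_top_iff_le (f : LexPower ω₁) :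
    ∃ (p : LexPower ω₁ → WithTop ℕ) (q : LexPower ω₁ → WithTop CountableOrdinal),
      Continuous p ∧ Continuous q ∧ ∀ g, p g = ⊤ ∧ q g = ⊤ ↔ f ≤ g := by
  by_cases hf : IsCofinal {β | f β = true}
  · obtain ⟨q, hq, -, htop⟩ := exists_continuous_countableOrdinal_eq_top_iff_le hf
    exact ⟨fun _ => ⊤, q, continuous_const, hq, by simpa using htop⟩
  · obtain ⟨p, hp, htop⟩ :=
      exists_continuous_nat_eq_top_iff_le (CountableOrdinal.countable_of_not_isCofinal hf)
    exact ⟨p, fun _ => ⊤, hp, continuous_const, by simpa using htop⟩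

theorem exists_continuous_pair_eq_top_iff_eq_of_isCofinal {f : LexPower ω₁}
    (hf : IsCofinal {β | f β = true}) :
    ∃ (p : LexPower ω₁ → WithTop ℕ) (q : LexPower ω₁ → WithTop CountableOrdinal),
      Continuous p ∧ Continuous q ∧ (∀ g, p g = ⊤ ∧ q g = ⊤ ↔ g = f) ∧
      ∀ i, ∃ g, p g = ⊤ ∧ q g = i := by
  obtain ⟨l, hl, hsurj, hl_top⟩ := exists_continuous_countableOrdinal_eq_top_iff_le hf
  obtain ⟨p, r, hp, hr, hpr_top⟩ := exists_continuous_pair_eq_top_iff_le (compl f)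
  have hupper (g : LexPower ω₁) : p (compl g) = ⊤ ∧ r (compl g) = ⊤ ↔ g ≤ f := by
    rw [hpr_top, compl_le_compl]
  refine ⟨p ∘ compl, fun g => min (l g) (r (compl g)), hp.comp continuous_compl,
    hl.min (hr.comp continuous_compl), fun g => ?_, fun i => ?_⟩
  · rw [min_eq_top, and_left_comm, hl_top, Function.comp_apply, hupper, and_comm, le_antisymm_iff]
  · rcases eq_or_ne i ⊤ with rfl | hi
    · obtain ⟨hp, hr⟩ := (hupper f).2 le_rfl
      exact ⟨f, hp, min_eq_top.2 ⟨(hl_top f).2 le_rfl, hr⟩⟩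
    · obtain ⟨g, rfl⟩ := hsurj i
      obtain ⟨hp, hr⟩ := (hupper g).2 (not_le.1 ((hl_top g).not.1 hi)).le
      exact ⟨g, hp, (congrArg _ hr).trans (min_top_right _)⟩

theorem exists_continuous_pair_eq_top_iff_eq (f : LexPower ω₁) :
    ∃ (p : LexPower ω₁ → WithTop ℕ) (q : LexPower ω₁ → WithTop CountableOrdinal),
      Continuous p ∧ Continuous q ∧ (∀ g, p g = ⊤ ∧ q g = ⊤ ↔ g = f) ∧
      ∀ i, ∃ g, p g = ⊤ ∧ q g = i := by
  rcases isCofinal_or_isCofinal_compl {β : CountableOrdinal | f β = true} with hf | hf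
  · exact exists_continuous_pair_eq_top_iff_eq_of_isCofinal hf
  · have hcompl : {β : CountableOrdinal | f β = true}ᶜ = {β | compl f β = true} := by
      ext β; simp
    obtain ⟨p, q, hp, hq, htop, hsurj⟩ :=
      exists_continuous_pair_eq_top_iff_eq_of_isCofinal (hcompl ▸ hf)
    refine ⟨p ∘ compl, q ∘ compl, hp.comp continuous_compl, hq.comp continuous_compl,
      fun g => ?_, fun i => ?_⟩
    · rw [Function.comp_apply, Function.comp_apply, htop,
        (Function.LeftInverse.injective compl_compl).eq_iff]
    · obtain ⟨g, hg⟩ := hsurj i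
      exact ⟨compl g, by simpa using hg⟩

end Level

theorem le_ofFun_true {α : Ordinal.{0}} (g : LexPower α) : g ≤ ofFun fun _ => true :=
  le_of_forall_apply_le fun _ => Bool.le_true _

theorem aleph_one_le_piCharacter_ofFun_true :
    ℵ₁ ≤ piCharacter (ofFun fun _ => true : LexPower ω₁) := by
  obtain ⟨q, hq, hsurj, htop⟩ :=
    exists_continuous_countableOrdinal_eq_top_iff_le (f := ofFun fun _ => true)
      fun β => ⟨β, rfl, le_rfl⟩
  have hpin : IsPinnedSurjection q (ofFun fun _ => true) ⊤ :=
    ⟨hq, hsurj, fun g => (htop g).trans (le_ofFun_true g).ge_iff_eq⟩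
  simpa using hpin.cof_le_piCharacter

theorem exists_piCharacter_le_aleph0 : ∃ f : LexPower ω₁, piCharacter f ≤ ℵ₀ := by
  obtain ⟨a, ha⟩ := Nat.exists_strictMono CountableOrdinal
  obtain ⟨f, hf⟩ := exists_isLUB (Set.range fun n => indicatorIio (a n))
  exact ⟨f, piCharacter_le_aleph0_of_isLUB (strictMono_indicatorIio.comp ha) hf⟩

end LexPower

namespace CantorLexProduct

theorem exists_isPinnedSurjection (x : CantorLexProduct) :
    ∃ φ : CantorLexProduct → WithTop ℕ × WithTop CountableOrdinal,
      IsPinnedSurjection φ x (⊤, ⊤) := by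
  obtain ⟨c, f⟩ := x
  obtain ⟨δ, hδ⟩ := exists_isPinnedSurjection_pi_nat c
  obtain ⟨p, q, hp, hq, htop, hsurj⟩ := LexPower.exists_continuous_pair_eq_top_iff_eq f
  refine ⟨fun y => (min (δ y.1) (p y.2), q y.2), ?_, fun ⟨n, i⟩ => ?_, fun ⟨d, g⟩ => ?_⟩
  · exact ((hδ.continuous.comp continuous_fst).min (hp.comp continuous_snd)).prodMk
      (hq.comp continuous_snd)
  · obtain ⟨d, rfl⟩ := hδ.surjective n
    obtain ⟨g, hg, rfl⟩ := hsurj i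
    exact ⟨(d, g), by simp [hg]⟩
  · simp only [Prod.mk.injEq, min_eq_top, and_assoc, htop, hδ.apply_eq_iff]

instance (x : CantorLexProduct) : (𝓝[≠] x).NeBot :=
  have ⟨_, hφ⟩ := exists_isPinnedSurjection x
  hφ.neBot_nhdsNE

theorem piCharacter_le_aleph_one (x : CantorLexProduct) : piCharacter x ≤ ℵ₁ := by
  obtain ⟨φ, hφ⟩ := exists_isPinnedSurjection x
  have hcard : #(ℕ × CountableOrdinal) = ℵ₁ := by
    simp [Cardinal.mk_prod]
  exact hcard ▸ piCharacter_le_of_hasBasis (hφ.hasBasis hasBasis_cornerBox)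

theorem piCharacter_eq_aleph0_or_eq_aleph_one (x : CantorLexProduct) :
    piCharacter x = ℵ₀ ∨ piCharacter x = ℵ₁ := by
  refine (aleph0_le_piCharacter x).eq_or_lt.imp Eq.symm fun h => ?_
  exact (piCharacter_le_aleph_one x).antisymm (Cardinal.succ_aleph0 ▸ Order.succ_le_of_lt h)

theorem exists_piCharacter_eq_aleph0 : ∃ x : CantorLexProduct, piCharacter x = ℵ₀ := by
  obtain ⟨f, hf⟩ := LexPower.exists_piCharacter_le_aleph0
  refine ⟨(fun _ => false, f), le_antisymm ?_ (aleph0_le_piCharacter _)⟩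
  calc piCharacter (fun _ => false, f)
      ≤ piCharacter (fun _ : ℕ => false) * piCharacter f := piCharacter_prod_le _ _
    _ ≤ ℵ₀ * ℵ₀ := mul_le_mul' (piCharacter_le_aleph0 _) hf
    _ = ℵ₀ := Cardinal.aleph0_mul_aleph0

theorem exists_piCharacter_eq_aleph_one : ∃ x : CantorLexProduct, piCharacter x = ℵ₁ :=
  ⟨(fun _ => false, LexPower.ofFun fun _ => true), (piCharacter_le_aleph_one _).antisymm <|
    LexPower.aleph_one_le_piCharacter_ofFun_true.trans <|
      piCharacter_le_of_isOpenMap isOpenMap_snd continuousAt_snd⟩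

end CantorLexProduct

/-- `K = 2^ω × 2^{ω₁}_lex` is a compact Hausdorff space and is pin homogeneous; each of its points
has `π`-character `ω` or `ω₁`, and both values occur; and every point of `K` has Tukey type
`ω × ω₁` (the product with the coordinatewise order). -/
theorem mainTheorem9 :
    CompactSpace CantorLexProduct ∧ T2Space CantorLexProduct ∧
      PinHomogeneous CantorLexProduct ∧
      (∀ x : CantorLexProduct, piCharacter x = ℵ₀ ∨ piCharacter x = ℵ₁) ∧
      (∃ x : CantorLexProduct, piCharacter x = ℵ₀) ∧
      (∃ x : CantorLexProduct, piCharacter x = ℵ₁) ∧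
      (∀ x : CantorLexProduct, TukeyEquiv (NhdsOrder x) (ℕ × (ω₁ : Ordinal.{0}).ToType)) := by
  refine ⟨inferInstance, inferInstance, fun x y => ?_,
    CantorLexProduct.piCharacter_eq_aleph0_or_eq_aleph_one,
    CantorLexProduct.exists_piCharacter_eq_aleph0,
    CantorLexProduct.exists_piCharacter_eq_aleph_one, fun x => ?_⟩
  · obtain ⟨φ, hφ⟩ := CantorLexProduct.exists_isPinnedSurjection x
    obtain ⟨ψ, hψ⟩ := CantorLexProduct.exists_isPinnedSurjection y
    exact hφ.pinEquiv hψ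
  · obtain ⟨φ, hφ⟩ := CantorLexProduct.exists_isPinnedSurjection x
    exact hφ.tukeyEquiv hasBasis_cornerBox fun _ _ => cornerBox_subset_cornerBox_iff
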